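/- For $A\in\mathbb R^{m\times n}$ let $\|A\|_2$ and $\|A\|_F$ be its spectral and Frobenius norms and put $q=\min(m,n)$. If $A=U\,\mathrm{diag}(s_1,\dots,s_q)V^{T}$ is a compact singular value decomposition, let $\mathrm{clip}^{sp}_c(A)=U\,\mathrm{diag}(\min(s_1,c),\dots,\min(s_q,c))V^{T}$. A random matrix $U\in\mathbb R^{d\times r}$ with $\mathbb E[U]=0$ and $U^{T}U=I_r$ has bounded anisotropy with parameter $\kappa>0$ if $\mathbb E[UU^{T}]\preceq\frac{\kappa r}{d}I_d$. Let $f:\mathbb R^{m\times n}\to\mathbb R$ be differentiable and bounded below, $f^*=\inf f$, and suppose that for some $L,M>0$ and all $X,Y$ we have $\|\nabla f(X)-\nabla f(Y)\|_F\le L\|X-Y\|_F$ and $\|\nabla f(X)\|_2\le M$. Let $r\ge1$, $\ell>0$, $\kappa>0$ with $25\kappa r^2\le q$. Suppose that at each point $X$ the stochastic gradient oracle returns $g(X)=\nabla f(X)+\ell\,U_XV_X^{T}$, where $U_X\in\mathbb R^{m\times r}$ and $V_X\in\mathbb R^{n\times r}$ are independent random matrices that both have bounded anisotropy with parameter $\kappa$,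 and that different oracle calls use independent randomness. Let $\epsilon>0$, let $X_0$ be a fixed matrix, $F^0=f(X_0)-f^*$, and consider $X_{k+1}=X_k-\eta\,\mathrm{clip}^{sp}_c(g(X_k))$ with $$c=10\sqrt r\,M,\qquad \eta=1\Big/\Big(\frac{6rL\min(10\sqrt r M,\,10\ell/9)^2}{\epsilon^2}+3L\Big).$$ Put $$B=\frac{36LF^0}{\epsilon^2}+72\min(10\sqrt r M,\,10\ell/9)^2\,\frac{rLF^0}{\epsilon^4}.$$ Then for every integer $K\ge1$ with $K\ge B$ we have $\mathbb E[\|\nabla f(\hat X_K)\|_F^2]\le\epsilon^2$, where $\hat X_K$ is sampled uniformly from $\{X_0,\dots,X_{K-1}\}$. Moreover, $B\simeq S$ with $S=\frac{LF^0}{\epsilon^2}+\min(\sqrt r M,\ell)^2\frac{rLF^0}{\epsilon^4}$, namely $36\,S\le B\le7200\,S$. -/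

import Mathlib

open MeasureTheory ProbabilityTheory
open scoped Matrix

noncomputable section

namespace SpikeSGD

/-- Real `m × n` matrices. -/
abbrev Mat (m n : ℕ) : Type := Matrix (Fin m) (Fin n) ℝ

/-- The Borel (equivalently, entrywise product) σ-algebra on real matrices. -/
instance instMeasurableSpaceMat (m n : ℕ) : MeasurableSpace (Mat m n) :=
  inferInstanceAs (MeasurableSpace (Fin m → Fin n → ℝ))

/-- The Frobenius norm. -/
def frobNorm {m n : ℕ} (A : Mat m n) : ℝ :=
  Real.sqrt (∑ i, ∑ j, A i j ^ 2)

/-- The spectral norm: the operator norm between Euclidean spaces. -/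
def specNorm {m n : ℕ} (A : Mat m n) : ℝ :=
  ‖LinearMap.toContinuousLinearMap (Matrix.toEuclideanLin A)‖

/-! ### Spectral clipping -/

/-- A compact singular value decomposition `A = U diag(s) Vᵀ`, with `q = min m n` columns in each of
the factors `U` and `V`. -/
structure IsCompactSVD {m n : ℕ} (A : Mat m n) (U : Mat m (min m n)) (s : Fin (min m n) → ℝ)
    (V : Mat n (min m n)) : Prop where
  left_orthonormal : Uᵀ * U = 1
  right_orthonormal : Vᵀ * V = 1
  nonneg : ∀ i, 0 ≤ s i
  eq : A = U * Matrix.diagonal s * Vᵀ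

theorem exists_svd_of_le {m n q : ℕ} (hq : q = n) (h : n ≤ m) (A : Mat m n) :
    ∃ (U : Mat m q) (s : Fin q → ℝ) (V : Mat n q),
      Uᵀ * U = 1 ∧ Vᵀ * V = 1 ∧ (∀ i, 0 ≤ s i) ∧ A = U * Matrix.diagonal s * Vᵀ := by
  subst hq
  have hH : (Aᵀ * A).IsHermitian := by
    simpa using Matrix.isHermitian_conjTranspose_mul_self A
  let b := hH.eigenvectorBasis
  let w : Fin q → EuclideanSpace ℝ (Fin m) := fun i => WithLp.toLp 2 (A *ᵥ (b i).ofLp)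
  have hb : ∀ i j, (b i).ofLp ⬝ᵥ (b j).ofLp = if i = j then 1 else 0 := by
    intro i j
    have := orthonormal_iff_ite.mp b.orthonormal j i
    rw [EuclideanSpace.inner_eq_star_dotProduct] at this
    simpa [eq_comm] using this
  have hw : ∀ i j, i ≠ j → inner ℝ (w i) (w j) = 0 := by
    intro i j hij
    rw [EuclideanSpace.inner_eq_star_dotProduct]
    have h1 : (w j).ofLp ⬝ᵥ star (w i).ofLp = (A *ᵥ (b j).ofLp) ⬝ᵥ (A *ᵥ (b i).ofLp) := by
      simp [w]
    rw [h1, Matrix.dotProduct_mulVec, Matrix.vecMul_mulVec, ← Matrix.dotProduct_mulVec]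
    have h2 := hH.mulVec_eigenvectorBasis i
    have h3 : (Aᵀ * A) *ᵥ (b i).ofLp = hH.eigenvalues i • (b i).ofLp := by simpa using h2
    have h4 := hb j i
    rw [if_neg (Ne.symm hij)] at h4
    rw [h3, dotProduct_smul, h4, smul_zero]
  let v : Fin m → EuclideanSpace ℝ (Fin m) := fun i =>
    if hi : i.1 < q then ‖w ⟨i, hi⟩‖⁻¹ • w ⟨i, hi⟩ else 0
  let S : Set (Fin m) := {i | ∃ hi : i.1 < q, w ⟨i, hi⟩ ≠ 0}
  have hv : Orthonormal ℝ (S.domRestrict v) := by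
    constructor
    · rintro ⟨i, hi, hne⟩
      simp only [Set.domRestrict_apply, v, dif_pos hi, norm_smul, norm_inv, norm_norm]
      exact inv_mul_cancel₀ (norm_ne_zero_iff.mpr hne)
    · rintro ⟨i, hi, hne⟩ ⟨j, hj, hne'⟩ hij
      simp only [Set.domRestrict_apply, v, dif_pos hi, dif_pos hj]
      rw [inner_smul_left, inner_smul_right, hw _ _ ?_]
      · simp
      · intro hc
        apply hij
        ext
        simpa using hc
  obtain ⟨u, hu⟩ := hv.exists_orthonormalBasis_extension_of_card_eq (by simp)
  have hwu : ∀ j : Fin q, w j = ‖w j‖ • u (Fin.castLE h j) := by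
    intro j
    by_cases hj : w j = 0
    · simp [hj]
    · have hmem : Fin.castLE h j ∈ S := ⟨j.2, hj⟩
      rw [hu _ hmem]
      have : v (Fin.castLE h j) = ‖w j‖⁻¹ • w j := by
        simp [v]
      rw [this, smul_smul, mul_inv_cancel₀ (norm_ne_zero_iff.mpr hj), one_smul]
  let V : Mat q q := Matrix.of fun i j => b j i
  let U : Mat m q := Matrix.of fun i j => u (Fin.castLE h j) i
  have hV : Vᵀ * V = 1 := by
    ext i j
    have := hb i j
    simpa [V, Matrix.mul_apply, Matrix.one_apply, dotProduct] using this
  have hU : Uᵀ * U = 1 := by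
    ext i j
    have := orthonormal_iff_ite.mp u.orthonormal (Fin.castLE h j) (Fin.castLE h i)
    rw [EuclideanSpace.inner_eq_star_dotProduct] at this
    simpa [U, Matrix.mul_apply, Matrix.one_apply, dotProduct, eq_comm] using this
  refine ⟨U, fun j => ‖w j‖, V, hU, hV, fun _ => norm_nonneg _, ?_⟩
  have hAV : A * V = U * Matrix.diagonal (fun j => ‖w j‖) := by
    ext i j
    have h1 := congrArg (fun x : EuclideanSpace ℝ (Fin m) => x i) (hwu j)
    simp only [PiLp.smul_apply, smul_eq_mul] at h1
    rw [Matrix.mul_diagonal]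
    have h2 : (A * V) i j = (w j) i := by
      simp [w, V, Matrix.mul_apply, Matrix.mulVec, dotProduct]
    rw [h2, h1, mul_comm]
    rfl
  rw [← hAV, Matrix.mul_assoc, mul_eq_one_comm.mp hV, Matrix.mul_one]

/-- Every real matrix has a compact singular value decomposition. -/
theorem exists_isCompactSVD {m n : ℕ} (A : Mat m n) :
    ∃ (U : Mat m (min m n)) (s : Fin (min m n) → ℝ) (V : Mat n (min m n)),
      IsCompactSVD A U s V := by
  rcases le_total n m with h | h
  · obtain ⟨U, s, V, h1, h2, h3, h4⟩ := exists_svd_of_le (min_eq_right h) h A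
    exact ⟨U, s, V, h1, h2, h3, h4⟩
  · obtain ⟨U, s, V, h1, h2, h3, h4⟩ := exists_svd_of_le (min_eq_left h) h Aᵀ
    refine ⟨V, s, U, h2, h1, h3, ?_⟩
    have := congrArg Matrix.transpose h4
    simpa [Matrix.transpose_mul, Matrix.mul_assoc] using this

/-- The scalar clipping function `sign(x) min(|x|, c)`. -/
def clip (c x : ℝ) : ℝ := Real.sign x * min |x| c

/-- Spectral clipping: if `A = U diag(s) Vᵀ` is a compact singular value decomposition, this is
`U diag(clip_c(s)) Vᵀ`. The result does not depend on the decomposition that is used, see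
`spectralClip_eq`. -/
def spectralClip {m n : ℕ} (c : ℝ) (A : Mat m n) : Mat m n :=
  (exists_isCompactSVD A).choose *
    Matrix.diagonal (fun i => clip c ((exists_isCompactSVD A).choose_spec.choose i)) *
    ((exists_isCompactSVD A).choose_spec.choose_spec.choose)ᵀ

theorem IsCompactSVD.mul_pow {m n : ℕ} {A : Mat m n} {U : Mat m (min m n)}
    {s : Fin (min m n) → ℝ} {V : Mat n (min m n)} (h : IsCompactSVD A U s V) (k : ℕ) :
    A * (Aᵀ * A) ^ k = U * Matrix.diagonal (fun i => s i * (s i ^ 2) ^ k) * Vᵀ := by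
  have hAA : Aᵀ * A = V * Matrix.diagonal (fun i => s i ^ 2) * Vᵀ := by
    have e : Aᵀ * A = V * (Matrix.diagonal s * (Uᵀ * U) * Matrix.diagonal s) * Vᵀ := by
      rw [h.eq]
      simp only [Matrix.transpose_mul, Matrix.transpose_transpose, Matrix.diagonal_transpose,
        Matrix.mul_assoc]
    rw [e, h.left_orthonormal, Matrix.mul_one, Matrix.diagonal_mul_diagonal]
    simp only [pow_two]
  induction k with
  | zero => simpa using h.eq
  | succ k ih =>
    rw [pow_succ, ← Matrix.mul_assoc, ih, hAA]
    have e : U * Matrix.diagonal (fun i => s i * (s i ^ 2) ^ k) * Vᵀ *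
        (V * Matrix.diagonal (fun i => s i ^ 2) * Vᵀ) =
        U * (Matrix.diagonal (fun i => s i * (s i ^ 2) ^ k) * (Vᵀ * V) *
          Matrix.diagonal (fun i => s i ^ 2)) * Vᵀ := by
      simp only [Matrix.mul_assoc]
    rw [e, h.right_orthonormal, Matrix.mul_one, Matrix.diagonal_mul_diagonal]
    simp only [pow_succ, mul_assoc]

theorem IsCompactSVD.sum_mul_pow {m n : ℕ} {A : Mat m n} {U : Mat m (min m n)}
    {s : Fin (min m n) → ℝ} {V : Mat n (min m n)} (h : IsCompactSVD A U s V)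
    (p : Polynomial ℝ) :
    ∑ k ∈ p.support, p.coeff k • (A * (Aᵀ * A) ^ k) =
      U * Matrix.diagonal (fun i => s i * p.eval (s i ^ 2)) * Vᵀ := by
  have e : Matrix.diagonal (fun i => s i * p.eval (s i ^ 2)) =
      ∑ k ∈ p.support, p.coeff k • Matrix.diagonal (fun i => s i * (s i ^ 2) ^ k) := by
    ext i j
    rw [Matrix.sum_apply]
    by_cases hij : i = j
    · subst hij
      simp only [Matrix.smul_apply, Matrix.diagonal_apply_eq, Polynomial.eval_eq_sum,
        Polynomial.sum, Finset.mul_sum, smul_eq_mul]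
      exact Finset.sum_congr rfl fun k _ => by ring
    · simp [Matrix.diagonal_apply_ne _ hij]
  rw [e, Matrix.mul_sum, Matrix.sum_mul]
  refine Finset.sum_congr rfl fun k _ => ?_
  rw [h.mul_pow, Matrix.mul_smul, Matrix.smul_mul]

/-- Spectral clipping can be computed from any compact singular value decomposition. -/
theorem spectralClip_eq {m n : ℕ} (c : ℝ) {A : Mat m n} {U : Mat m (min m n)}
    {s : Fin (min m n) → ℝ} {V : Mat n (min m n)} (h : IsCompactSVD A U s V) :
    spectralClip c A = U * Matrix.diagonal (fun i => clip c (s i)) * Vᵀ := by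
  have h' := (exists_isCompactSVD A).choose_spec.choose_spec.choose_spec
  unfold spectralClip
  set U' := (exists_isCompactSVD A).choose
  set s' := (exists_isCompactSVD A).choose_spec.choose
  set V' := (exists_isCompactSVD A).choose_spec.choose_spec.choose
  classical
  let T : Finset ℝ := Finset.univ.image (fun i => s i ^ 2) ∪ Finset.univ.image (fun i => s' i ^ 2)
  let g : ℝ → ℝ := fun t => clip c (Real.sqrt t) / Real.sqrt t
  let p : Polynomial ℝ := Lagrange.interpolate T id g
  have hp : ∀ t ∈ T, p.eval t = g t := fun t ht =>
    Lagrange.eval_interpolate_at_node g Function.injective_id.injOn ht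
  have key : ∀ x : ℝ, 0 ≤ x → x ^ 2 ∈ T → x * p.eval (x ^ 2) = clip c x := by
    intro x hx hxT
    rw [hp _ hxT]
    simp only [g, Real.sqrt_sq hx]
    rcases hx.eq_or_lt with h0 | h0
    · simp [← h0, clip]
    · field_simp
  have e1 := h.sum_mul_pow p
  have e2 := h'.sum_mul_pow p
  have k1 : (fun i => s i * p.eval (s i ^ 2)) = fun i => clip c (s i) := by
    funext i
    exact key _ (h.nonneg i) (by simp [T])
  have k2 : (fun i => s' i * p.eval (s' i ^ 2)) = fun i => clip c (s' i) := by
    funext i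
    exact key _ (h'.nonneg i) (by simp [T])
  rw [k1] at e1
  rw [k2] at e2
  rw [← e1, ← e2]

/-! ### The objective -/

/-- The gradient of `f` with respect to the Frobenius inner product, i.e. the matrix of partial
derivatives (meaningful when `f` is differentiable). -/
def gradient {m n : ℕ} (f : Mat m n → ℝ) (X : Mat m n) : Mat m n :=
  Matrix.of fun i j => fderiv ℝ f X (Matrix.single i j 1)

/-- `f` is differentiable and its gradient is `L`-Lipschitz for the Frobenius norm. -/
structure IsLSmooth {m n : ℕ} (f : Mat m n → ℝ) (L : ℝ) : Prop where
  differentiable : Differentiable ℝ f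
  lipschitz : ∀ X Y, frobNorm (gradient f X - gradient f Y) ≤ L * frobNorm (X - Y)

/-! ### The noise -/

/-- The entrywise expectation of a random matrix. -/
def expectation {Ξ : Type*} [MeasurableSpace Ξ] (ν : Measure Ξ) {a b : ℕ} (A : Ξ → Mat a b) :
    Mat a b :=
  Matrix.of fun i j => ∫ ξ, A ξ i j ∂ν

/-- A zero-mean random `d × r` matrix with orthonormal columns that has bounded anisotropy with
parameter `κ`: `E[U Uᵀ] ≼ (κ r / d) I`. -/
structure HasBoundedAnisotropy {Ξ : Type*} [MeasurableSpace Ξ] (ν : Measure Ξ) {d r : ℕ}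
    (U : Ξ → Mat d r) (κ : ℝ) : Prop where
  measurable : Measurable U
  kappa_pos : 0 < κ
  orthonormal : ∀ᵐ ξ ∂ν, (U ξ)ᵀ * U ξ = 1
  mean_zero : expectation ν U = 0
  anisotropy :
    ((κ * r / d) • (1 : Mat d d) - expectation ν (fun ξ => U ξ * (U ξ)ᵀ)).PosSemidef

/-- The factors `U_X`, `V_X` of the rank-`r` spike noise `ℓ U_X V_Xᵀ`: a call of the oracle at `X`
draws `ξ` from `ν`, and `U_X = U X ξ`, `V_X = V X ξ`. -/
structure IsSpikeNoise {Ξ : Type*} [MeasurableSpace Ξ] (ν : Measure Ξ) {m n r : ℕ}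
    (U : Mat m n → Ξ → Mat m r) (V : Mat m n → Ξ → Mat n r) (κ : ℝ) : Prop where
  measurable_left : Measurable (fun p : Mat m n × Ξ => U p.1 p.2)
  measurable_right : Measurable (fun p : Mat m n × Ξ => V p.1 p.2)
  indep : ∀ X, IndepFun (U X) (V X) ν
  left : ∀ X, HasBoundedAnisotropy ν (U X) κ
  right : ∀ X, HasBoundedAnisotropy ν (V X) κ

/-- The stochastic gradient `g(X) = ∇f(X) + ℓ U_X V_Xᵀ`. -/
def stochGrad {Ξ : Type*} {m n r : ℕ} (f : Mat m n → ℝ) (l : ℝ)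
    (U : Mat m n → Ξ → Mat m r) (V : Mat m n → Ξ → Mat n r) (X : Mat m n) (ξ : Ξ) : Mat m n :=
  gradient f X + l • (U X ξ * (V X ξ)ᵀ)

/-! ### The method -/

/-- `X` is a run of the stochastic gradient method with spectral clipping
`X (k+1) = X k - η clip_c(g(X k))` from `X₀`, where the calls of the stochastic gradient oracle `g`
use independent draws `ξ k` from `ν`. -/
structure IsClippedSGD {Ω Ξ : Type*} [MeasurableSpace Ω] [MeasurableSpace Ξ] (P : Measure Ω)
    (ν : Measure Ξ) {m n : ℕ} (g : Mat m n → Ξ → Mat m n) (η c : ℝ) (X₀ : Mat m n)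
    (ξ : ℕ → Ω → Ξ) (X : ℕ → Ω → Mat m n) : Prop where
  measurable : ∀ k, Measurable (ξ k)
  law : ∀ k, P.map (ξ k) = ν
  indep : iIndepFun ξ P
  init : ∀ ω, X 0 ω = X₀
  step : ∀ k ω, X (k + 1) ω = X k ω - η • spectralClip c (g (X k ω) (ξ k ω))

/-- `J` is a uniformly random index in `{0, …, K - 1}`, independent of the iterates
`X 0, …, X (K - 1)`. -/
structure IsUniformIndex {Ω : Type*} [MeasurableSpace Ω] (P : Measure Ω) {m n : ℕ}
    (X : ℕ → Ω → Mat m n) {K : ℕ} (J : Ω → Fin K) : Prop where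
  measurable : Measurable J
  law : P.map J = uniformOn Set.univ
  indep : IndepFun J (fun ω => fun k : Fin K => X k ω) P

end SpikeSGD

end

/-! Write `G` for the gradient, `T = U Vᵀ` for the spike, `S` for the clipped stochastic gradient
and `a = min l c`. Since `c ≥ M`, the gradient lies in the spectral ball of radius `c`, and clipping
is the Frobenius projection onto that ball (`frobInner_sub_spectralClip_le`). Everything about `S`
is deduced from the variational inequality of this projection, tested against well-chosen members of
the ball; no singular vectors of `G + l T` are perturbed.

Let `H` be the part of `G` orthogonal to the column spaces of `U` and `V`. The competitor `a T + H`
is in the ball because its two summands act between orthogonal subspaces. It gives `⟨G, S⟩ ≥ a ⟨T,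
G⟩ + ‖H‖² / 2` (`frobInner_spectralClip_spike_ge`). The competitors `0` and `c T` give `‖S‖² ≤ ‖G‖²
+ r a²` up to a multiple of `⟨T, G⟩` (`frobInner_spectralClip_spike_self_le`). So clipping lowers
the noise energy from `r l²` to `r a²` while keeping the correlation with `G`.

In expectation `⟨T, G⟩` vanishes by independence and zero mean, and bounded anisotropy makes `Uᵀ G`
and `G V` each carry at most 1/25 of `‖G‖²`. With the descent lemma, one step lowers `f` on average
by at least `η/6 ‖G‖² - L η² r a² / 2` (`integral_guaranteedDecrease_ge`). Each oracle draw is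
independent of the current iterate, so this telescopes along the run
(`IsClippedSGD.sum_integral_le`), and the choice of `η` balances the two resulting error terms. -/

namespace SpikeSGD

/-! ### The Frobenius inner product -/

/-- The Frobenius inner product. -/
def frobInner {m n : ℕ} (A B : Mat m n) : ℝ := ∑ i, ∑ j, A i j * B i j

section FrobInner

variable {m n p : ℕ}

theorem frobNorm_sq (A : Mat m n) : frobNorm A ^ 2 = frobInner A A := by
  rw [frobNorm, Real.sq_sqrt (by positivity)]
  simp [frobInner, pow_two]

theorem frobNorm_nonneg (A : Mat m n) : 0 ≤ frobNorm A := Real.sqrt_nonneg _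

theorem frobInner_self_nonneg (A : Mat m n) : 0 ≤ frobInner A A := by
  rw [← frobNorm_sq]; positivity

theorem frobInner_comm (A B : Mat m n) : frobInner A B = frobInner B A := by
  simp [frobInner, mul_comm]

theorem frobInner_add_left (A B C : Mat m n) :
    frobInner (A + B) C = frobInner A C + frobInner B C := by
  simp [frobInner, add_mul, Finset.sum_add_distrib]

theorem frobInner_sub_left (A B C : Mat m n) :
    frobInner (A - B) C = frobInner A C - frobInner B C := by
  simp [frobInner, sub_mul, Finset.sum_sub_distrib]

theorem frobInner_smul_left (a : ℝ) (A C : Mat m n) :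
    frobInner (a • A) C = a * frobInner A C := by
  simp [frobInner, mul_assoc, Finset.mul_sum]

theorem frobInner_add_right (A B C : Mat m n) :
    frobInner C (A + B) = frobInner C A + frobInner C B := by
  simp [frobInner, mul_add, Finset.sum_add_distrib]

theorem frobInner_sub_right (A B C : Mat m n) :
    frobInner C (A - B) = frobInner C A - frobInner C B := by
  simp [frobInner, mul_sub, Finset.sum_sub_distrib]

theorem frobInner_smul_right (a : ℝ) (A C : Mat m n) :
    frobInner C (a • A) = a * frobInner C A := by
  rw [frobInner_comm, frobInner_smul_left, frobInner_comm]

@[simp] theorem frobInner_zero_left (A : Mat m n) : frobInner 0 A = 0 := by simp [frobInner]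

@[simp] theorem frobInner_zero_right (A : Mat m n) : frobInner A 0 = 0 := by simp [frobInner]

theorem frobInner_eq_trace (A B : Mat m n) : frobInner A B = (Aᵀ * B).trace := by
  simp only [frobInner, Matrix.trace, Matrix.diag, Matrix.mul_apply, Matrix.transpose_apply]
  exact Finset.sum_comm

theorem frobInner_mul_left (A : Mat m p) (B : Mat p n) (C : Mat m n) :
    frobInner (A * B) C = frobInner B (Aᵀ * C) := by
  simp [frobInner_eq_trace, Matrix.mul_assoc]

theorem frobInner_mul_right (A : Mat m p) (B : Mat p n) (C : Mat m n) :
    frobInner (A * B) C = frobInner A (C * Bᵀ) := by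
  rw [frobInner_eq_trace, frobInner_eq_trace, Matrix.transpose_mul, Matrix.mul_assoc,
    Matrix.trace_mul_comm, Matrix.mul_assoc]

theorem frobInner_le_frobNorm_mul (A B : Mat m n) :
    frobInner A B ≤ frobNorm A * frobNorm B := by
  have h := Finset.sum_mul_sq_le_sq_mul_sq (Finset.univ : Finset (Fin m × Fin n))
    (fun p => A p.1 p.2) (fun p => B p.1 p.2)
  simp only [Fintype.sum_prod_type] at h
  refine Real.le_sqrt_of_sq_le h |>.trans_eq ?_
  rw [Real.sqrt_mul (by positivity)]
  rfl

theorem sq_apply_le_frobInner (A : Mat m n) (i : Fin m) (j : Fin n) :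
    A i j ^ 2 ≤ frobInner A A := by
  simp only [frobInner, ← pow_two]
  exact (Finset.single_le_sum (f := fun j => A i j ^ 2) (fun j _ => sq_nonneg _)
    (Finset.mem_univ j)).trans (Finset.single_le_sum (f := fun i => ∑ j, A i j ^ 2)
      (fun i _ => Finset.sum_nonneg fun j _ => sq_nonneg _) (Finset.mem_univ i))

/-- A matrix with orthonormal columns preserves the Frobenius inner product. -/
theorem frobInner_mul_mul_of_orthonormal {U : Mat m p} (hU : Uᵀ * U = 1) (A B : Mat p n) :
    frobInner (U * A) (U * B) = frobInner A B := by
  rw [frobInner_mul_left, ← Matrix.mul_assoc, hU, Matrix.one_mul]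

theorem frobInner_transpose (A B : Mat m n) : frobInner Aᵀ Bᵀ = frobInner A B :=
  Finset.sum_comm

end FrobInner

/-! ### The spectral norm ball -/

/-- The matrix `A` expands Euclidean lengths by a factor of at most `c` (for `c ≥ 0`). -/
def SpecLE {m n : ℕ} (A : Mat m n) (c : ℝ) : Prop :=
  ∀ y, (A *ᵥ y) ⬝ᵥ (A *ᵥ y) ≤ c ^ 2 * (y ⬝ᵥ y)

section SpecLE

variable {m n p : ℕ}

theorem specLE_of_specNorm_le {A : Mat m n} {c : ℝ} (h : specNorm A ≤ c) : SpecLE A c := by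
  intro y
  have h1 := (LinearMap.toContinuousLinearMap (Matrix.toEuclideanLin A)).le_of_opNorm_le h
    (WithLp.toLp 2 y)
  have h2 := pow_le_pow_left₀ (norm_nonneg _) h1 2
  rw [mul_pow, EuclideanSpace.norm_sq_eq, EuclideanSpace.norm_sq_eq] at h2
  simpa [dotProduct, pow_two] using h2

theorem mulVec_dotProduct_mulVec_of_orthonormal {U : Mat m p} (hU : Uᵀ * U = 1)
    (z w : Fin p → ℝ) : (U *ᵥ z) ⬝ᵥ (U *ᵥ w) = z ⬝ᵥ w := by
  rw [Matrix.dotProduct_mulVec, ← Matrix.mulVec_transpose, Matrix.mulVec_mulVec, hU,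
    Matrix.one_mulVec]

theorem mulVec_dotProduct_eq (U : Mat m p) (z : Fin p → ℝ) (y : Fin m → ℝ) :
    (U *ᵥ z) ⬝ᵥ y = z ⬝ᵥ (Uᵀ *ᵥ y) := by
  rw [dotProduct_comm, Matrix.dotProduct_mulVec, ← Matrix.mulVec_transpose, dotProduct_comm]

theorem dotProduct_self_sub_proj {U : Mat m p} (hU : Uᵀ * U = 1) (y : Fin m → ℝ) :
    (y - U *ᵥ (Uᵀ *ᵥ y)) ⬝ᵥ (y - U *ᵥ (Uᵀ *ᵥ y)) =
      y ⬝ᵥ y - (Uᵀ *ᵥ y) ⬝ᵥ (Uᵀ *ᵥ y) := by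
  rw [sub_dotProduct, dotProduct_sub, dotProduct_sub, mulVec_dotProduct_mulVec_of_orthonormal hU,
    dotProduct_comm y (U *ᵥ _), mulVec_dotProduct_eq]
  ring

theorem dotProduct_self_transpose_mulVec_le {U : Mat m p} (hU : Uᵀ * U = 1) (y : Fin m → ℝ) :
    (Uᵀ *ᵥ y) ⬝ᵥ (Uᵀ *ᵥ y) ≤ y ⬝ᵥ y := by
  have h := dotProduct_self_sub_proj hU y
  have h' := dotProduct_self_star_nonneg (y - U *ᵥ (Uᵀ *ᵥ y))
  simp only [star_trivial] at h'
  linarith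

/-- `Vᵀ` does not lengthen vectors, the diagonal scales each coordinate by at most `c`, and `U` is
an isometry. -/
theorem specLE_mul_diagonal_mul {U : Mat m p} {V : Mat n p} (hU : Uᵀ * U = 1) (hV : Vᵀ * V = 1)
    {t : Fin p → ℝ} {c : ℝ} (ht : ∀ i, |t i| ≤ c) : SpecLE (U * Matrix.diagonal t * Vᵀ) c := by
  intro y
  rw [← Matrix.mulVec_mulVec, ← Matrix.mulVec_mulVec, mulVec_dotProduct_mulVec_of_orthonormal hU]
  refine le_trans ?_ (mul_le_mul_of_nonneg_left (dotProduct_self_transpose_mulVec_le hV y)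
    (sq_nonneg c))
  simp only [dotProduct, Matrix.mulVec_diagonal, Finset.mul_sum]
  refine Finset.sum_le_sum fun i _ => ?_
  have : t i ^ 2 ≤ c ^ 2 := sq_le_sq.mpr ((ht i).trans (le_abs_self c))
  nlinarith [mul_le_mul_of_nonneg_right this (mul_self_nonneg ((Vᵀ *ᵥ y) i))]

/-- The entry is `uᵢᵀ A vᵢ` for unit columns `uᵢ`, `vᵢ`, so Cauchy–Schwarz applies. -/
theorem SpecLE.diag_le {A : Mat m n} {c : ℝ} (h : SpecLE A c) (hc : 0 ≤ c) {U : Mat m p}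
    {V : Mat n p} (hU : Uᵀ * U = 1) (hV : Vᵀ * V = 1) (i : Fin p) : (Uᵀ * A * V) i i ≤ c := by
  have hcol : ∀ {d : ℕ} (W : Mat d p), Wᵀ * W = 1 → W.col i ⬝ᵥ W.col i = 1 := by
    intro d W hW
    have := congrFun (congrFun hW i) i
    simpa [Matrix.mul_apply, dotProduct] using this
  have e : (Uᵀ * A * V) i i = U.col i ⬝ᵥ (A *ᵥ V.col i) := by
    rw [Matrix.mul_assoc]
    simp [Matrix.mul_apply, dotProduct, Matrix.mulVec]
  have h1 := h (V.col i)
  have h2 := Finset.sum_mul_sq_le_sq_mul_sq Finset.univ (U.col i) (A *ᵥ V.col i)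
  have h3 : ∀ {d : ℕ} (x : Fin d → ℝ), ∑ j, x j ^ 2 = x ⬝ᵥ x := by
    intro d x; simp [dotProduct, pow_two]
  rw [h3, h3, hcol U hU, one_mul] at h2
  rw [hcol V hV, mul_one] at h1
  rw [e]
  exact abs_le_of_sq_le_sq' (h2.trans h1) hc |>.2

theorem frobInner_mul_diagonal_mul (U : Mat m p) (V : Mat n p) (t : Fin p → ℝ) (A : Mat m n) :
    frobInner (U * Matrix.diagonal t * Vᵀ) A = ∑ i, t i * (Uᵀ * A * V) i i := by
  rw [frobInner_mul_right, frobInner_mul_left, Matrix.transpose_transpose, ← Matrix.mul_assoc,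
    frobInner_eq_trace, Matrix.diagonal_transpose]
  simp [Matrix.trace, Matrix.diagonal_mul]

theorem frobInner_mul_transpose (U : Mat m p) (V : Mat n p) (A : Mat m n) :
    frobInner (U * Vᵀ) A = ∑ i, (Uᵀ * A * V) i i := by
  simpa using frobInner_mul_diagonal_mul U V (fun _ => 1) A

end SpecLE

/-! ### Spectral clipping as a projection -/

section SpectralClip

variable {m n p : ℕ} {c : ℝ}

theorem clip_eq_min (hc : 0 ≤ c) {x : ℝ} (hx : 0 ≤ x) : clip c x = min x c := by
  rcases hx.eq_or_lt with h | h
  · simp [← h, clip, hc]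
  · simp [clip, Real.sign_of_pos h, abs_of_pos h]

theorem specLE_spectralClip (hc : 0 ≤ c) (A : Mat m n) : SpecLE (spectralClip c A) c := by
  obtain ⟨U, s, V, h⟩ := exists_isCompactSVD A
  rw [spectralClip_eq c h]
  refine specLE_mul_diagonal_mul h.left_orthonormal h.right_orthonormal fun i => ?_
  rw [clip_eq_min hc (h.nonneg i), abs_of_nonneg (le_min (h.nonneg i) hc)]
  exact min_le_right _ _

/-- Variational inequality: `spectralClip c A` is the Frobenius projection of `A` onto the spectral
norm ball of radius `c`. -/
theorem frobInner_sub_spectralClip_le (hc : 0 ≤ c) (A : Mat m n) {W : Mat m n}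
    (hW : SpecLE W c) : frobInner (A - spectralClip c A) (W - spectralClip c A) ≤ 0 := by
  obtain ⟨U, s, V, h⟩ := exists_isCompactSVD A
  rw [spectralClip_eq c h]
  have e : A - U * Matrix.diagonal (fun i => clip c (s i)) * Vᵀ =
      U * Matrix.diagonal (fun i => s i - clip c (s i)) * Vᵀ := by
    conv_lhs => rw [h.eq]
    rw [← Matrix.sub_mul, ← Matrix.mul_sub, Matrix.diagonal_sub]
  have e2 : Uᵀ * (U * Matrix.diagonal (fun i => clip c (s i)) * Vᵀ) * V =
      Matrix.diagonal (fun i => clip c (s i)) := by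
    calc _ = (Uᵀ * U) * Matrix.diagonal (fun i => clip c (s i)) * (Vᵀ * V) := by
          simp only [Matrix.mul_assoc]
      _ = _ := by rw [h.left_orthonormal, h.right_orthonormal, Matrix.one_mul, Matrix.mul_one]
  rw [e, frobInner_sub_right, frobInner_mul_diagonal_mul, frobInner_mul_diagonal_mul, e2,
    ← Finset.sum_sub_distrib]
  refine Finset.sum_nonpos fun i _ => ?_
  have hd := hW.diag_le hc h.left_orthonormal h.right_orthonormal i
  rw [Matrix.diagonal_apply_eq, clip_eq_min hc (h.nonneg i)]
  -- Either `s i` is not clipped and the first factor vanishes, or the clipped value is `c`, which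
  -- dominates the diagonal entry of `W`.
  rcases le_total (s i) c with h1 | h1
  · simp [h1]
  · rw [min_eq_right h1]
    nlinarith

/-- Spectral clipping is nonexpansive. -/
theorem frobInner_spectralClip_sub_le (hc : 0 ≤ c) (A B : Mat m n) :
    frobInner (spectralClip c A - spectralClip c B) (spectralClip c A - spectralClip c B) ≤
      frobInner (A - B) (A - B) := by
  have h1 := frobInner_sub_spectralClip_le hc A (specLE_spectralClip hc B)
  have h2 := frobInner_sub_spectralClip_le hc B (specLE_spectralClip hc A)
  set S := spectralClip c A
  set T := spectralClip c B
  -- Adding `h1` and `h2` gives `‖S - T‖² ≤ ⟨A - B, S - T⟩`; this square removes the inner product.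
  have h3 := frobInner_self_nonneg ((A - B) - (S - T))
  simp only [frobInner_sub_left, frobInner_sub_right] at *
  have c1 := frobInner_comm A B
  have c2 := frobInner_comm A S
  have c3 := frobInner_comm A T
  have c4 := frobInner_comm B S
  have c5 := frobInner_comm B T
  have c6 := frobInner_comm S T
  linarith

theorem specLE_zero (c : ℝ) : SpecLE (0 : Mat m n) c := by
  intro y
  have := dotProduct_self_star_nonneg y
  simp only [star_trivial] at this
  simp only [Matrix.zero_mulVec, dotProduct_zero]
  positivity

/-- The projection is tested against the competitor `0`. -/
theorem frobInner_spectralClip_self_le (hc : 0 ≤ c) (A : Mat m n) :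
    frobInner (spectralClip c A) (spectralClip c A) ≤ frobInner A A := by
  have h1 := frobInner_sub_spectralClip_le hc A (specLE_zero c)
  have h3 := frobInner_self_nonneg (A - spectralClip c A)
  simp only [zero_sub, frobInner_sub_left, frobInner_sub_right, ← neg_one_smul ℝ (spectralClip c A),
    frobInner_smul_right] at *
  have c2 := frobInner_comm A (spectralClip c A)
  linarith

/-- Each column is the image of a unit vector. This crude bound serves only for boundedness and
integrability. -/
theorem SpecLE.frobInner_self_le {A : Mat m n} (h : SpecLE A c) :
    frobInner A A ≤ n * c ^ 2 := by
  have e : frobInner A A = ∑ j, (A *ᵥ Pi.single j 1) ⬝ᵥ (A *ᵥ Pi.single j 1) := by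
    simp only [frobInner, Matrix.mulVec_single_one, dotProduct, Matrix.col_apply]
    exact Finset.sum_comm
  rw [e]
  refine (Finset.sum_le_sum fun j _ => h _).trans ?_
  simp

end SpectralClip

/-! ### Clipping a bounded matrix perturbed by a spike -/

section Spike

variable {m n r : ℕ} {U : Mat m r} {V : Mat n r} {G : Mat m n} {c l : ℝ}

theorem frobInner_spike_self (hU : Uᵀ * U = 1) (hV : Vᵀ * V = 1) :
    frobInner (U * Vᵀ) (U * Vᵀ) = r := by
  rw [frobInner_mul_mul_of_orthonormal hU, frobInner_transpose]
  rw [frobInner_eq_trace, hV]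
  simp

theorem frobInner_spike_le (hU : Uᵀ * U = 1) (hV : Vᵀ * V = 1) (hc : 0 ≤ c) {A : Mat m n}
    (hA : SpecLE A c) : frobInner (U * Vᵀ) A ≤ r * c := by
  rw [frobInner_mul_transpose]
  refine (Finset.sum_le_sum fun i _ => hA.diag_le hc hU hV i).trans_eq ?_
  simp

/-- The part of `G` orthogonal to the column spaces of `U` and `V`. -/
def offSpike (U : Mat m r) (V : Mat n r) (G : Mat m n) : Mat m n :=
  (1 - U * Uᵀ) * G * (1 - V * Vᵀ)

theorem transpose_mul_offSpike (hU : Uᵀ * U = 1) : Uᵀ * offSpike U V G = 0 := by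
  rw [offSpike, Matrix.mul_assoc, ← Matrix.mul_assoc Uᵀ, Matrix.mul_sub, ← Matrix.mul_assoc Uᵀ, hU]
  simp

theorem offSpike_mul (hV : Vᵀ * V = 1) : offSpike U V G * V = 0 := by
  rw [offSpike, Matrix.mul_assoc, Matrix.sub_mul 1 (V * Vᵀ), Matrix.mul_assoc V, hV]
  simp

theorem offSpike_eq : offSpike U V G =
    G - U * (Uᵀ * G) - G * V * Vᵀ + U * (Uᵀ * G * V) * Vᵀ := by
  simp only [offSpike, Matrix.sub_mul, Matrix.mul_sub, Matrix.one_mul, Matrix.mul_one,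
    Matrix.mul_assoc]
  abel

/-- `offSpike U V` is an orthogonal projection on matrices: every term removed from `G` is
orthogonal to the result. -/
theorem frobInner_offSpike_self (hU : Uᵀ * U = 1) (hV : Vᵀ * V = 1) :
    frobInner (offSpike U V G) (offSpike U V G) = frobInner (offSpike U V G) G := by
  conv_lhs => rw [frobInner_comm]; enter [1]; rw [offSpike_eq]
  simp only [frobInner_add_left, frobInner_sub_left]
  rw [frobInner_mul_left U, transpose_mul_offSpike hU, frobInner_mul_right _ Vᵀ,
    frobInner_mul_right _ Vᵀ, Matrix.transpose_transpose, offSpike_mul hV, frobInner_comm G]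
  simp

/-- Inclusion–exclusion: the two sides differ by `‖Uᵀ G V‖²`, the overlap that is subtracted twice.
-/
theorem frobInner_offSpike_ge :
    frobInner G G - frobInner (Uᵀ * G) (Uᵀ * G) - frobInner (G * V) (G * V) ≤
      frobInner (offSpike U V G) G := by
  have h := frobInner_self_nonneg (Uᵀ * G * V)
  rw [offSpike_eq]
  simp only [frobInner_add_left, frobInner_sub_left]
  rw [frobInner_mul_left U, frobInner_mul_right _ Vᵀ, frobInner_mul_right _ Vᵀ,
    Matrix.transpose_transpose, frobInner_mul_left U, ← Matrix.mul_assoc]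
  linarith

/-- The spike sees only the component of `y` in the range of `V` and maps into the range of `U`; the
other summand sees only the remainder `z` and maps into the orthogonal complement. Both input and
output therefore split by Pythagoras, and each block expands by at most `c`. -/
theorem specLE_spike_add_offSpike (hU : Uᵀ * U = 1) (hV : Vᵀ * V = 1) {a : ℝ} (ha : 0 ≤ a)
    (hac : a ≤ c) (hG : SpecLE G c) : SpecLE (a • (U * Vᵀ) + offSpike U V G) c := by
  intro y
  set z := y - V *ᵥ (Vᵀ *ᵥ y) with hz
  set x := G *ᵥ z
  have e : (a • (U * Vᵀ) + offSpike U V G) *ᵥ y =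
      U *ᵥ (a • (Vᵀ *ᵥ y)) + (x - U *ᵥ (Uᵀ *ᵥ x)) := by
    rw [Matrix.add_mulVec, Matrix.smul_mulVec, ← Matrix.mulVec_mulVec, Matrix.mulVec_smul,
      offSpike, ← Matrix.mulVec_mulVec, ← Matrix.mulVec_mulVec, Matrix.sub_mulVec 1 (V * Vᵀ),
      Matrix.one_mulVec, ← Matrix.mulVec_mulVec, ← hz, Matrix.sub_mulVec, Matrix.one_mulVec,
      ← Matrix.mulVec_mulVec]
  have h0 : (U *ᵥ (a • (Vᵀ *ᵥ y))) ⬝ᵥ (x - U *ᵥ (Uᵀ *ᵥ x)) = 0 := by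
    rw [dotProduct_sub, mulVec_dotProduct_mulVec_of_orthonormal hU, mulVec_dotProduct_eq, sub_self]
  rw [e, add_dotProduct, dotProduct_add, dotProduct_add, h0, dotProduct_comm (x - _) (U *ᵥ _), h0,
    mulVec_dotProduct_mulVec_of_orthonormal hU, dotProduct_self_sub_proj hU]
  have h1 := hG z
  rw [hz, dotProduct_self_sub_proj hV, ← hz] at h1
  have h2 := dotProduct_self_star_nonneg (Uᵀ *ᵥ x)
  have h3 := dotProduct_self_star_nonneg (Vᵀ *ᵥ y)
  simp only [star_trivial] at h2 h3
  have h4 : a ^ 2 ≤ c ^ 2 := pow_le_pow_left₀ ha hac 2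
  have h5 := mul_le_mul_of_nonneg_right h4 h3
  simp only [smul_dotProduct, dotProduct_smul, smul_eq_mul]
  change G *ᵥ z ⬝ᵥ G *ᵥ z ≤ _ at h1
  change _ + 0 + (0 + (G *ᵥ z ⬝ᵥ G *ᵥ z - _)) ≤ _
  nlinarith

/-- Correlation of the clipped stochastic gradient with the gradient. -/
theorem frobInner_spectralClip_spike_ge (hU : Uᵀ * U = 1) (hV : Vᵀ * V = 1) (hc : 0 ≤ c)
    (hl : 0 ≤ l) (hG : SpecLE G c) :
    min l c * frobInner (U * Vᵀ) G +
      (frobInner G G - frobInner (Uᵀ * G) (Uᵀ * G) - frobInner (G * V) (G * V)) / 2 ≤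
    frobInner G (spectralClip c (G + l • (U * Vᵀ))) := by
  have ha : 0 ≤ min l c := le_min hl hc
  have hp := frobInner_sub_spectralClip_le hc (G + l • (U * Vᵀ))
    (specLE_spike_add_offSpike hU hV ha (min_le_right l c) hG)
  have hs := specLE_spectralClip hc (G + l • (U * Vᵀ))
  set S := spectralClip c (G + l • (U * Vᵀ))
  have hTT := frobInner_spike_self hU hV
  have hTS := frobInner_spike_le hU hV hc hs
  have hHH := frobInner_offSpike_self (G := G) hU hV
  have hHG := frobInner_offSpike_ge (U := U) (V := V) (G := G)
  have hTH : frobInner (U * Vᵀ) (offSpike U V G) = 0 := by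
    rw [frobInner_mul_left, transpose_mul_offSpike hU, frobInner_zero_right]
  set T := U * Vᵀ
  set H := offSpike U V G
  -- With `x = S - a T`, the competitor leaves `‖x‖² - ⟨x, H⟩` to be bounded below by `-‖H‖² / 2`,
  -- which is the average of `q1` and `q2`; half of `⟨H, G⟩ = ‖H‖²` survives.
  have q1 := frobInner_self_nonneg (S - (min l c • T + H))
  have q2 := frobInner_self_nonneg (S - min l c • T)
  -- This replaces `l` by `min l c`: either they agree, or the minimum is `c` and `⟨T, S⟩ ≤ r c`.
  have q3 : (l - min l c) * (frobInner T S - min l c * r) ≤ 0 := by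
    rcases le_total l c with h | h
    · simp [h]
    · rw [min_eq_right h]
      nlinarith
  simp only [frobInner_sub_left, frobInner_sub_right, frobInner_add_left, frobInner_add_right,
    frobInner_smul_left, frobInner_smul_right] at *
  rw [frobInner_comm S T, frobInner_comm S H, frobInner_comm H T, frobInner_comm H G,
    frobInner_comm G T, hTT, hTH] at *
  linarith

/-- The size of the clipped stochastic gradient. -/
theorem frobInner_spectralClip_spike_self_le (hU : Uᵀ * U = 1) (hV : Vᵀ * V = 1) (hc : 0 ≤ c) :
    frobInner (spectralClip c (G + l • (U * Vᵀ))) (spectralClip c (G + l • (U * Vᵀ))) ≤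
      frobInner G G + r * min l c ^ 2 + 2 * (if l ≤ c then l else 0) * frobInner (U * Vᵀ) G := by
  have hTT := frobInner_spike_self hU hV
  split_ifs with h
  · refine (frobInner_spectralClip_self_le hc _).trans_eq ?_
    rw [min_eq_left h]
    simp only [frobInner_add_left, frobInner_add_right, frobInner_smul_left, frobInner_smul_right,
      hTT, frobInner_comm G (U * Vᵀ)]
    ring
  · rw [min_eq_right (not_le.mp h).le]
    have hs := specLE_spectralClip hc (G + l • (U * Vᵀ))
    have hTS := frobInner_spike_le hU hV hc hs
    have hT : SpecLE (c • (U * Vᵀ)) c := by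
      have := specLE_mul_diagonal_mul hU hV (t := fun _ => c) (c := c) (fun _ => (abs_of_nonneg hc).le)
      have e : Matrix.diagonal (fun _ : Fin r => c) = c • (1 : Mat r r) := by
        simp [Matrix.smul_one_eq_diagonal]
      rwa [e, Matrix.mul_smul, Matrix.mul_one, Matrix.smul_mul] at this
    have hp := frobInner_sub_spectralClip_le hc (G + l • (U * Vᵀ)) hT
    set S := spectralClip c (G + l • (U * Vᵀ))
    set T := U * Vᵀ
    -- With `x = S - c T`, the competitor `c T` and `q3` give `‖x‖² ≤ ⟨G, x⟩`, so `‖x‖ ≤ ‖G‖`; by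
    -- `q4` the cross term in `‖x + c T‖²` is nonpositive.
    have q := frobInner_self_nonneg (G - (S - c • T))
    have q3 : (l - c) * (frobInner T S - c * r) ≤ 0 := by
      nlinarith [not_le.mp h]
    have q4 : c * (frobInner T S - c * r) ≤ 0 := by nlinarith
    simp only [frobInner_sub_left, frobInner_sub_right, frobInner_add_left,
      frobInner_smul_left, frobInner_smul_right] at *
    rw [frobInner_comm S T, frobInner_comm S G, frobInner_comm G T, hTT] at *
    nlinarith

end Spike

end SpikeSGD

namespace SpikeSGD

instance instBorelSpaceMat (m n : ℕ) : BorelSpace (Mat m n) :=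
  inferInstanceAs (BorelSpace (Fin m → Fin n → ℝ))

/-! ### Smooth functions on matrices -/

section Smooth

variable {m n : ℕ}

@[fun_prop]
theorem continuous_frobNorm : Continuous (frobNorm : Mat m n → ℝ) := by
  unfold frobNorm
  fun_prop

@[fun_prop]
theorem Continuous.frobInner {α : Type*} [TopologicalSpace α] {A B : α → Mat m n}
    (hA : Continuous A) (hB : Continuous B) : Continuous fun x => frobInner (A x) (B x) := by
  unfold SpikeSGD.frobInner
  fun_prop

/-- Maps that are Lipschitz for the Frobenius norm are continuous. -/
theorem continuous_of_frobNorm_sub_le {Φ : Mat m n → Mat m n} {C : ℝ}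
    (h : ∀ X Y, frobNorm (Φ X - Φ Y) ≤ C * frobNorm (X - Y)) : Continuous Φ := by
  refine continuous_matrix fun i j => continuous_iff_continuousAt.mpr fun Y => ?_
  rw [ContinuousAt, tendsto_iff_dist_tendsto_zero]
  have h0 : Filter.Tendsto (fun X => C * frobNorm (X - Y)) (nhds Y) (nhds 0) := by
    have hc : Continuous fun X => C * frobNorm (X - Y) := by fun_prop
    have := hc.tendsto Y
    simpa [frobNorm] using this
  refine squeeze_zero (fun _ => dist_nonneg) (fun X => ?_) h0
  refine le_trans ?_ (h X Y)
  rw [Real.dist_eq, ← Matrix.sub_apply]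
  refine abs_le_of_sq_le_sq ?_ (frobNorm_nonneg _)
  rw [frobNorm_sq]
  exact sq_apply_le_frobInner _ i j

/-- Nonexpansiveness yields continuity, hence measurability, although the definition picks a
decomposition by choice. -/
theorem continuous_spectralClip {c : ℝ} (hc : 0 ≤ c) :
    Continuous (spectralClip c : Mat m n → Mat m n) := by
  refine continuous_of_frobNorm_sub_le (C := 1) fun X Y => ?_
  rw [one_mul]
  refine (sq_le_sq₀ (frobNorm_nonneg _) (frobNorm_nonneg _)).mp ?_
  rw [frobNorm_sq, frobNorm_sq]
  exact frobInner_spectralClip_sub_le hc X Y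

theorem IsLSmooth.continuous_gradient {f : Mat m n → ℝ} {L : ℝ} (h : IsLSmooth f L) :
    Continuous (gradient f) := continuous_of_frobNorm_sub_le h.lipschitz

theorem fderiv_eq_frobInner (f : Mat m n → ℝ) (X D : Mat m n) :
    fderiv ℝ f X D = frobInner (gradient f X) D := by
  conv_lhs => rw [Matrix.matrix_eq_sum_single D]
  simp only [map_sum, frobInner, gradient, Matrix.of_apply]
  refine Finset.sum_congr rfl fun i _ => Finset.sum_congr rfl fun j _ => ?_
  have : Matrix.single i j (D i j) = D i j • Matrix.single i j (1 : ℝ) := by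
    simp
  rw [this, map_smul, smul_eq_mul, mul_comm]

section

-- The chain rule is applied in the entrywise sup norm, which induces the product topology and so
-- leaves the derivative unchanged.
attribute [local instance] Matrix.normedAddCommGroup Matrix.normedSpace

theorem hasDerivAt_line {f : Mat m n → ℝ} (hf : Differentiable ℝ f) (X D : Mat m n) (t : ℝ) :
    HasDerivAt (fun t : ℝ => f (X + t • D)) (frobInner (gradient f (X + t • D)) D) t := by
  have h1 := ((hasDerivAt_id t).smul_const D).const_add X
  rw [one_smul] at h1
  rw [← fderiv_eq_frobInner]
  exact ((hf (X + t • D)).hasFDerivAt).comp_hasDerivAt t h1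

end

theorem IsLSmooth.continuous {f : Mat m n → ℝ} {L : ℝ} (h : IsLSmooth f L) : Continuous f :=
  h.differentiable.continuous

/-- The descent lemma. -/
theorem IsLSmooth.le_quadratic {f : Mat m n → ℝ} {L : ℝ} (h : IsLSmooth f L) (X D : Mat m n) :
    f (X + D) ≤ f X + frobInner (gradient f X) D + L / 2 * frobInner D D := by
  -- The claim is `k 1 ≤ k 0`; the quadratic term absorbs the Lipschitz growth of the directional
  -- derivative.
  let k : ℝ → ℝ := fun t =>
    f (X + t • D) - t * frobInner (gradient f X) D - L / 2 * frobInner D D * t ^ 2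
  have hk : ∀ t, HasDerivAt k (frobInner (gradient f (X + t • D)) D -
      frobInner (gradient f X) D - L * frobInner D D * t) t := by
    intro t
    have h1 := ((hasDerivAt_line h.differentiable X D t).sub
      ((hasDerivAt_id t).mul_const (frobInner (gradient f X) D))).sub
      (((hasDerivAt_id t).pow 2).const_mul (L / 2 * frobInner D D))
    refine h1.congr_deriv ?_
    simp
    ring
  have hanti : AntitoneOn k (Set.Icc 0 1) := by
    refine antitoneOn_of_deriv_nonpos (convex_Icc 0 1)
      (fun t _ => (hk t).continuousAt.continuousWithinAt)
      (fun t _ => (hk t).differentiableAt.differentiableWithinAt) fun t ht => ?_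
    rw [interior_Icc] at ht
    rw [(hk t).deriv, ← frobInner_sub_left]
    have h1 := frobInner_le_frobNorm_mul (gradient f (X + t • D) - gradient f X) D
    have h2 := h.lipschitz (X + t • D) X
    have h3 : frobNorm (X + t • D - X) = t * frobNorm D := by
      refine (sq_eq_sq₀ (frobNorm_nonneg _) (mul_nonneg ht.1.le (frobNorm_nonneg _))).mp ?_
      rw [add_sub_cancel_left, mul_pow, frobNorm_sq, frobNorm_sq, frobInner_smul_left,
        frobInner_smul_right]
      ring
    rw [h3] at h2
    have h4 := mul_le_mul_of_nonneg_right h2 (frobNorm_nonneg D)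
    rw [← frobNorm_sq D]
    linarith
  have := hanti (Set.left_mem_Icc.mpr zero_le_one) (Set.right_mem_Icc.mpr zero_le_one) zero_le_one
  simp only [k, one_smul, zero_smul, add_zero] at this
  linarith

end Smooth

end SpikeSGD

namespace SpikeSGD

/-! ### Expectations of the spike noise -/

section Noise

variable {Ξ : Type*} [MeasurableSpace Ξ] {ν : Measure Ξ} {d m n r : ℕ} {κ : ℝ}

theorem measurable_entry {α : Type*} [MeasurableSpace α] {a b : ℕ} {A : α → Mat a b}
    (hA : Measurable A) (i : Fin a) (j : Fin b) : Measurable fun x => A x i j :=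
  measurable_pi_iff.mp (measurable_pi_iff.mp hA i) j

theorem Measurable.frobInner {α : Type*} [MeasurableSpace α] {a b : ℕ} {A B : α → Mat a b}
    (hA : Measurable A) (hB : Measurable B) : Measurable fun x => frobInner (A x) (B x) :=
  Finset.measurable_sum _ fun i _ => Finset.measurable_sum _ fun j _ =>
    (measurable_entry hA i j).mul (measurable_entry hB i j)

theorem abs_apply_le_of_orthonormal {U : Mat d r} (hU : Uᵀ * U = 1) (i : Fin d) (k : Fin r) :
    |U i k| ≤ Real.sqrt r := by
  refine Real.abs_le_sqrt ((sq_apply_le_frobInner U i k).trans_eq ?_)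
  rw [frobInner_eq_trace, hU]
  simp

theorem integrable_frobInner {a b : ℕ} {A : Ξ → Mat a b}
    (hA : ∀ i j, Integrable (fun ξ => A ξ i j) ν) (G : Mat a b) :
    Integrable (fun ξ => frobInner (A ξ) G) ν :=
  integrable_finsetSum _ fun i _ => integrable_finsetSum _ fun j _ => (hA i j).mul_const _

theorem integral_frobInner {a b : ℕ} {A : Ξ → Mat a b}
    (hA : ∀ i j, Integrable (fun ξ => A ξ i j) ν) (G : Mat a b) :
    ∫ ξ, frobInner (A ξ) G ∂ν = frobInner (expectation ν A) G := by
  unfold frobInner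
  refine (integral_finsetSum _ fun i _ =>
    integrable_finsetSum _ fun j _ => (hA i j).mul_const (G i j)).trans ?_
  refine Finset.sum_congr rfl fun i _ => ?_
  refine (integral_finsetSum _ fun j _ => (hA i j).mul_const (G i j)).trans ?_
  refine Finset.sum_congr rfl fun j _ => ?_
  rw [integral_mul_const]
  rfl

theorem integrable_mul_transpose_apply [IsProbabilityMeasure ν] {U : Ξ → Mat m r}
    {V : Ξ → Mat n r} (hUm : Measurable U) (hVm : Measurable V)
    (hU : ∀ᵐ ξ ∂ν, (U ξ)ᵀ * U ξ = 1) (hV : ∀ᵐ ξ ∂ν, (V ξ)ᵀ * V ξ = 1) (i : Fin m) (j : Fin n) :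
    Integrable (fun ξ => (U ξ * (V ξ)ᵀ) i j) ν := by
  simp only [Matrix.mul_apply, Matrix.transpose_apply]
  refine integrable_finsetSum _ fun k _ => ?_
  refine Integrable.of_bound
    ((measurable_entry hUm i k).mul (measurable_entry hVm j k)).aestronglyMeasurable
    (Real.sqrt r * Real.sqrt r) ?_
  filter_upwards [hU, hV] with ξ h1 h2
  rw [Real.norm_eq_abs, abs_mul]
  exact mul_le_mul (abs_apply_le_of_orthonormal h1 i k) (abs_apply_le_of_orthonormal h2 j k)
    (abs_nonneg _) (Real.sqrt_nonneg _)

/-- Independence factors each entrywise expectation, and the mean of `U` is zero. -/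
theorem HasBoundedAnisotropy.expectation_mul_transpose_eq_zero [IsProbabilityMeasure ν]
    {U : Ξ → Mat m r} {V : Ξ → Mat n r} (hU : HasBoundedAnisotropy ν U κ)
    (hV : HasBoundedAnisotropy ν V κ) (hind : IndepFun U V ν) :
    expectation ν (fun ξ => U ξ * (V ξ)ᵀ) = 0 := by
  ext i j
  simp only [expectation, Matrix.of_apply, Matrix.mul_apply, Matrix.transpose_apply,
    Matrix.zero_apply]
  have hint : ∀ k, IndepFun (fun ξ => U ξ i k) (fun ξ => V ξ j k) ν := fun k =>
    hind.comp (measurable_entry measurable_id i k) (measurable_entry measurable_id j k)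
  have h0 : ∀ k, ∫ ξ, U ξ i k ∂ν = 0 := fun k => by
    simpa [expectation] using congrFun (congrFun hU.mean_zero i) k
  rw [integral_finsetSum]
  · refine Finset.sum_eq_zero fun k _ => ?_
    rw [(hint k).integral_fun_mul_eq_mul_integral
      (measurable_entry hU.measurable i k).aestronglyMeasurable
      (measurable_entry hV.measurable j k).aestronglyMeasurable, h0, zero_mul]
  · intro k _
    refine Integrable.of_bound ((measurable_entry hU.measurable i k).mul
      (measurable_entry hV.measurable j k)).aestronglyMeasurable (Real.sqrt r * Real.sqrt r) ?_
    filter_upwards [hU.orthonormal, hV.orthonormal] with ξ h1 h2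
    rw [Real.norm_eq_abs, abs_mul]
    exact mul_le_mul (abs_apply_le_of_orthonormal h1 i k) (abs_apply_le_of_orthonormal h2 j k)
      (abs_nonneg _) (Real.sqrt_nonneg _)

/-- The right side is linear in `U Uᵀ`, so an expectation can be moved inside and compared with the
anisotropy bound. -/
theorem frobInner_transpose_mul_self (U : Mat d r) (G : Mat d n) :
    frobInner (Uᵀ * G) (Uᵀ * G) = frobInner (U * Uᵀ) (G * Gᵀ) := by
  rw [frobInner_mul_left, frobInner_comm (U * Uᵀ), frobInner_mul_right G, Matrix.transpose_transpose,
    Matrix.transpose_transpose, Matrix.mul_assoc]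

/-- The value is the trace of `Gᵀ A G`. -/
theorem frobInner_mul_transpose_nonneg {A : Mat d d} (hA : A.PosSemidef) (G : Mat d n) :
    0 ≤ frobInner A (G * Gᵀ) := by
  have h := (hA.conjTranspose_mul_mul_same G).trace_nonneg
  rw [frobInner_comm, frobInner_mul_right, Matrix.transpose_transpose, frobInner_eq_trace,
    ← Matrix.mul_assoc]
  simpa using h

theorem HasBoundedAnisotropy.integrable_frobInner_transpose_mul [IsProbabilityMeasure ν]
    {U : Ξ → Mat d r} (hU : HasBoundedAnisotropy ν U κ) (G : Mat d n) :
    Integrable (fun ξ => frobInner ((U ξ)ᵀ * G) ((U ξ)ᵀ * G)) ν := by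
  simp only [frobInner_transpose_mul_self]
  exact integrable_frobInner (integrable_mul_transpose_apply hU.measurable hU.measurable
    hU.orthonormal hU.orthonormal) _

theorem HasBoundedAnisotropy.integral_frobInner_transpose_mul_le [IsProbabilityMeasure ν]
    {U : Ξ → Mat d r} (hU : HasBoundedAnisotropy ν U κ) (G : Mat d n) :
    ∫ ξ, frobInner ((U ξ)ᵀ * G) ((U ξ)ᵀ * G) ∂ν ≤ κ * r / d * frobInner G G := by
  simp only [frobInner_transpose_mul_self]
  rw [integral_frobInner (integrable_mul_transpose_apply hU.measurable hU.measurable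
    hU.orthonormal hU.orthonormal)]
  have h := frobInner_mul_transpose_nonneg hU.anisotropy G
  rw [frobInner_sub_left, frobInner_smul_left] at h
  have e : frobInner (1 : Mat d d) (G * Gᵀ) = frobInner G G := by
    rw [frobInner_comm, frobInner_mul_right, Matrix.transpose_transpose, Matrix.one_mul]
  rw [e] at h
  linarith

theorem anisotropy_ratio_le (hr : 1 ≤ r) (hκ0 : 0 < κ) {q : ℕ} (hκ : 25 * κ * (r : ℝ) ^ 2 ≤ q)
    (hqd : q ≤ d) : κ * r / d ≤ 1 / 25 := by
  have hr' : (1 : ℝ) ≤ r := by exact_mod_cast hr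
  have hd : (q : ℝ) ≤ d := by exact_mod_cast hqd
  have h1 : κ * r ≤ κ * (r : ℝ) ^ 2 := by nlinarith [mul_pos hκ0 (zero_lt_one.trans_le hr')]
  have hpos : 0 < κ * (r : ℝ) := by positivity
  rw [div_le_div_iff₀ (by linarith) (by norm_num)]
  linarith

end Noise

/-! ### One step of the method -/

section Step

variable {Ξ : Type*} [MeasurableSpace Ξ] {ν : Measure Ξ} {m n r : ℕ} {κ L M l η c : ℝ}
  {f : Mat m n → ℝ} {U : Mat m n → Ξ → Mat m r} {V : Mat m n → Ξ → Mat n r}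

/-- The decrease of `f` that the descent lemma guarantees for a step in the direction `S` when the
gradient is `G`. -/
noncomputable def guaranteedDecrease {m n : ℕ} (L η : ℝ) (G S : Mat m n) : ℝ :=
  η * frobInner G S - L / 2 * η ^ 2 * frobInner S S

theorem IsLSmooth.step_le (h : IsLSmooth f L) (X S : Mat m n) :
    f (X - η • S) ≤ f X - guaranteedDecrease L η (gradient f X) S := by
  have := h.le_quadratic X (-(η • S))
  rw [← sub_eq_add_neg] at this
  rw [guaranteedDecrease]
  rw [← neg_smul, frobInner_smul_right, frobInner_smul_left, frobInner_smul_right] at this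
  linarith

/-- A crude uniform bound, needed only to make every expectation along the run finite. -/
theorem abs_guaranteedDecrease_le {G S : Mat m n} (hL : 0 ≤ L) (hη : 0 ≤ η) (hG : SpecLE G M)
    (hS : SpecLE S c) : |guaranteedDecrease L η G S| ≤
      η * (n * M ^ 2 + n * c ^ 2) + L / 2 * η ^ 2 * (n * c ^ 2) := by
  have hG' := hG.frobInner_self_le
  have hS' := hS.frobInner_self_le
  have h0 := frobInner_self_nonneg S
  have h1 := frobInner_self_nonneg (G + S)
  have h2 := frobInner_self_nonneg (G - S)
  have h3 := frobInner_self_nonneg G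
  simp only [frobInner_add_left, frobInner_add_right, frobInner_sub_left, frobInner_sub_right,
    frobInner_comm S G] at h1 h2
  have h4 : |frobInner G S| ≤ n * M ^ 2 + n * c ^ 2 := abs_le.mpr ⟨by linarith, by linarith⟩
  have h5 : 0 ≤ L / 2 * η ^ 2 := by positivity
  refine (abs_sub _ _).trans ?_
  rw [abs_mul, abs_mul, abs_of_nonneg hη, abs_of_nonneg h5, abs_of_nonneg h0]
  gcongr

theorem measurable_stochGrad (hf : Measurable (gradient f)) (hnoise : IsSpikeNoise ν U V κ) :
    Measurable fun p : Mat m n × Ξ => stochGrad f l U V p.1 p.2 := by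
  have hg : Measurable fun p : Mat m n × Ξ => gradient f p.1 := hf.comp measurable_fst
  refine measurable_pi_iff.mpr fun i => measurable_pi_iff.mpr fun j => ?_
  simp only [stochGrad, Matrix.add_apply, Matrix.smul_apply, Matrix.mul_apply,
    Matrix.transpose_apply, smul_eq_mul]
  exact (measurable_entry hg i j).add ((Finset.measurable_sum _ fun k _ =>
    (measurable_entry hnoise.measurable_left i k).mul
      (measurable_entry hnoise.measurable_right j k)).const_mul l)

theorem measurable_guaranteedDecrease {α : Type*} [MeasurableSpace α] {G S : α → Mat m n}
    (hG : Measurable G) (hS : Measurable S) :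
    Measurable fun x => guaranteedDecrease L η (G x) (S x) :=
  ((Measurable.frobInner hG hS).const_mul _).sub ((Measurable.frobInner hS hS).const_mul _)

/-- Expected decrease in one step from a fixed point. -/
theorem integral_guaranteedDecrease_ge [IsProbabilityMeasure ν] (hr : 1 ≤ r)
    (hnoise : IsSpikeNoise ν U V κ) (hκ : 25 * κ * (r : ℝ) ^ 2 ≤ ((min m n : ℕ) : ℝ))
    (hsmooth : IsLSmooth f L) (hL : 0 < L) (hη : 0 < η) (hc : 0 ≤ c) (hl : 0 ≤ l) (X : Mat m n)
    (hG : SpecLE (gradient f X) c) (hLη : L * η ≤ 1 / 3) :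
    η / 6 * frobInner (gradient f X) (gradient f X) - L / 2 * η ^ 2 * (r * min l c ^ 2) ≤
      ∫ ξ, guaranteedDecrease L η (gradient f X)
        (spectralClip c (stochGrad f l U V X ξ)) ∂ν := by
  have hU := hnoise.left X
  have hV := hnoise.right X
  have hmeas : Measurable fun ξ => spectralClip c (stochGrad f l U V X ξ) :=
    (continuous_spectralClip hc).measurable.comp
      ((measurable_stochGrad hsmooth.continuous_gradient.measurable hnoise).comp
        measurable_prodMk_left)
  set G := gradient f X
  have hGG := frobInner_self_nonneg G
  set d : ℝ := if l ≤ c then l else 0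
  -- The total coefficient of `⟨U Vᵀ, G⟩` in the two spike bounds; its value is irrelevant because
  -- that term has mean zero.
  set α : ℝ := η * min l c - L * η ^ 2 * d
  have iT : Integrable (fun ξ => frobInner (U X ξ * (V X ξ)ᵀ) G) ν :=
    integrable_frobInner (integrable_mul_transpose_apply hU.measurable hV.measurable
      hU.orthonormal hV.orthonormal) G
  have eT : ∫ ξ, frobInner (U X ξ * (V X ξ)ᵀ) G ∂ν = 0 := by
    rw [integral_frobInner (integrable_mul_transpose_apply hU.measurable hV.measurable
      hU.orthonormal hV.orthonormal),
      hU.expectation_mul_transpose_eq_zero hV (hnoise.indep X), frobInner_zero_left]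
  -- Transposing turns the right factor into a left one, so the same anisotropy bound serves `V`.
  have eV : ∀ ξ, frobInner (G * V X ξ) (G * V X ξ) =
      frobInner ((V X ξ)ᵀ * Gᵀ) ((V X ξ)ᵀ * Gᵀ) := fun ξ => by
    rw [← frobInner_transpose, Matrix.transpose_mul]
  have iU := hU.integrable_frobInner_transpose_mul G
  have bU := hU.integral_frobInner_transpose_mul_le G
  have iV := hV.integrable_frobInner_transpose_mul Gᵀ
  have bV := hV.integral_frobInner_transpose_mul_le Gᵀ
  rw [frobInner_transpose] at bV
  have cU := mul_le_mul_of_nonneg_right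
    (anisotropy_ratio_le hr hU.kappa_pos hκ (min_le_left m n)) hGG
  have cV := mul_le_mul_of_nonneg_right
    (anisotropy_ratio_le hr hU.kappa_pos hκ (min_le_right m n)) hGG
  simp only [← eV] at iV bV
  have hlow : ∀ᵐ ξ ∂ν, α * frobInner (U X ξ * (V X ξ)ᵀ) G + ((η / 2 - L / 2 * η ^ 2) *
      frobInner G G - L / 2 * η ^ 2 * (r * min l c ^ 2) -
        η / 2 * frobInner ((U X ξ)ᵀ * G) ((U X ξ)ᵀ * G) -
        η / 2 * frobInner (G * V X ξ) (G * V X ξ)) ≤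
      guaranteedDecrease L η G (spectralClip c (stochGrad f l U V X ξ)) := by
    filter_upwards [hU.orthonormal, hV.orthonormal] with ξ h1 h2
    have a1 := mul_le_mul_of_nonneg_left (frobInner_spectralClip_spike_ge h1 h2 hc hl hG) hη.le
    have a2 := mul_le_mul_of_nonneg_left
      (frobInner_spectralClip_spike_self_le (G := G) (l := l) h1 h2 hc)
      (show 0 ≤ L / 2 * η ^ 2 by positivity)
    simp only [guaranteedDecrease, stochGrad, α, d] at *
    linarith
  have iD : Integrable (fun ξ => guaranteedDecrease L η G
      (spectralClip c (stochGrad f l U V X ξ))) ν :=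
    Integrable.of_bound (measurable_guaranteedDecrease measurable_const hmeas).aestronglyMeasurable
      _ (Filter.Eventually.of_forall fun ξ =>
        abs_guaranteedDecrease_le hL.le hη.le hG (specLE_spectralClip hc _))
  have i1 := iT.const_mul α
  have i2 := (integrable_const (μ := ν) ((η / 2 - L / 2 * η ^ 2) *
      frobInner G G - L / 2 * η ^ 2 * (r * min l c ^ 2))).sub (iU.const_mul (η / 2))
  have i3 := iV.const_mul (η / 2)
  have key := integral_mono_ae (i1.add (i2.sub i3)) iD hlow
  rw [integral_add' i1 (i2.sub i3), integral_sub' i2 i3, integral_sub' (integrable_const _)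
    (iU.const_mul (η / 2)), integral_const_mul, integral_const_mul, integral_const_mul, eT,
    integral_const] at key
  simp only [probReal_univ, one_smul, mul_zero, zero_add] at key
  refine le_trans ?_ key
  -- The coefficient of `η ‖G‖²` is at least 1/2 - 2/50 - 1/6, which exceeds 1/6.
  have k1 := mul_le_mul_of_nonneg_left (bU.trans cU) (show 0 ≤ η / 2 by positivity)
  have k2 := mul_le_mul_of_nonneg_left (bV.trans cV) (show 0 ≤ η / 2 by positivity)
  have k3 := mul_le_mul_of_nonneg_right hLη (mul_nonneg hη.le hGG)
  have k4 := mul_nonneg hη.le hGG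
  linarith

end Step

end SpikeSGD

namespace SpikeSGD

/-! ### Runs of the method -/

section Run

variable {Ω Ξ : Type*} [MeasurableSpace Ω] [MeasurableSpace Ξ] {P : Measure Ω} {ν : Measure Ξ}
  {m n : ℕ} {g : Mat m n → Ξ → Mat m n} {η c : ℝ} {X₀ : Mat m n} {ξ : ℕ → Ω → Ξ}
  {X : ℕ → Ω → Mat m n}

theorem measurable_clippedStep (hc : 0 ≤ c) (hg : Measurable fun p : Mat m n × Ξ => g p.1 p.2) :
    Measurable fun p : Mat m n × Ξ => p.1 - η • spectralClip c (g p.1 p.2) := by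
  have hS : Measurable fun p : Mat m n × Ξ => spectralClip c (g p.1 p.2) :=
    (continuous_spectralClip hc).measurable.comp hg
  refine measurable_pi_iff.mpr fun i => measurable_pi_iff.mpr fun j => ?_
  exact (measurable_entry measurable_fst i j).sub ((measurable_entry hS i j).const_mul η)

/-- The `k`-th iterate is a measurable function of the first `k` oracle draws. -/
theorem IsClippedSGD.exists_eq_comp (h : IsClippedSGD P ν g η c X₀ ξ X) (hc : 0 ≤ c)
    (hg : Measurable fun p : Mat m n × Ξ => g p.1 p.2) (k : ℕ) :
    ∃ F : (Finset.range k → Ξ) → Mat m n, Measurable F ∧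
      ∀ ω, X k ω = F fun i => ξ i ω := by
  induction k with
  | zero => exact ⟨fun _ => X₀, measurable_const, h.init⟩
  | succ k ih =>
    obtain ⟨F, hF, hX⟩ := ih
    let past : (Finset.range (k + 1) → Ξ) → (Finset.range k → Ξ) := fun y i =>
      y ⟨i, Finset.range_subset_range.mpr k.le_succ i.2⟩
    have hpast : Measurable past := measurable_pi_iff.mpr fun i => measurable_pi_apply _
    refine ⟨fun y => F (past y) - η • spectralClip c (g (F (past y))
      (y ⟨k, Finset.self_mem_range_succ k⟩)), ?_, fun ω => ?_⟩
    · exact (measurable_clippedStep hc hg).comp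
        ((hF.comp hpast).prodMk (measurable_pi_apply _))
    · rw [h.step, hX]

theorem IsClippedSGD.measurable_iterate (h : IsClippedSGD P ν g η c X₀ ξ X) (hc : 0 ≤ c)
    (hg : Measurable fun p : Mat m n × Ξ => g p.1 p.2) (k : ℕ) : Measurable (X k) := by
  obtain ⟨F, hF, hX⟩ := h.exists_eq_comp hc hg k
  rw [show X k = fun ω => F fun i => ξ i ω from funext hX]
  exact hF.comp (measurable_pi_iff.mpr fun i => h.measurable i)

theorem IsClippedSGD.indepFun_iterate (h : IsClippedSGD P ν g η c X₀ ξ X) (hc : 0 ≤ c)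
    (hg : Measurable fun p : Mat m n × Ξ => g p.1 p.2) (k : ℕ) : IndepFun (X k) (ξ k) P := by
  obtain ⟨F, hF, hX⟩ := h.exists_eq_comp hc hg k
  have hi := h.indep.indepFun_finset (Finset.range k) {k} (by simp) h.measurable
  rw [show X k = fun ω => F fun i => ξ i ω from funext hX]
  exact hi.comp hF (measurable_pi_apply (⟨k, Finset.mem_singleton_self k⟩ : ({k} : Finset ℕ)))

/-- Iterate and fresh draw are independent, so Fubini can integrate the draw out with the iterate
held fixed. -/
theorem IsClippedSGD.map_prodMk [IsProbabilityMeasure P] (h : IsClippedSGD P ν g η c X₀ ξ X)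
    (hc : 0 ≤ c) (hg : Measurable fun p : Mat m n × Ξ => g p.1 p.2) (k : ℕ) :
    P.map (fun ω => (X k ω, ξ k ω)) = (P.map (X k)).prod ν := by
  rw [(indepFun_iff_map_prod_eq_prod_map_map (h.measurable_iterate hc hg k).aemeasurable
    (h.measurable k).aemeasurable).mp (h.indepFun_iterate hc hg k), h.law]

/-- If the expectation over a fresh draw is bounded below at each point, then so is the expectation
along the run. -/
theorem IsClippedSGD.integral_ge [IsProbabilityMeasure P] [IsProbabilityMeasure ν]
    (h : IsClippedSGD P ν g η c X₀ ξ X)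
    (hc : 0 ≤ c) (hg : Measurable fun p : Mat m n × Ξ => g p.1 p.2) (k : ℕ)
    {δ : Mat m n × Ξ → ℝ} (hδ : Measurable δ) {C : ℝ} (hC : ∀ p, |δ p| ≤ C) {φ : Mat m n → ℝ}
    (hφ : Measurable φ) {C' : ℝ} (hC' : ∀ x, |φ x| ≤ C') (hle : ∀ x, φ x ≤ ∫ y, δ (x, y) ∂ν) :
    ∫ ω, φ (X k ω) ∂P ≤ ∫ ω, δ (X k ω, ξ k ω) ∂P := by
  have hX := h.measurable_iterate hc hg k
  have : IsProbabilityMeasure (P.map (X k)) := Measure.isProbabilityMeasure_map hX.aemeasurable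
  have hint : Integrable δ ((P.map (X k)).prod ν) :=
    Integrable.of_bound hδ.aestronglyMeasurable C (Filter.Eventually.of_forall hC)
  rw [← integral_map (φ := fun ω => (X k ω, ξ k ω)) (f := δ) (hX.prodMk (h.measurable k)).aemeasurable
    hδ.aestronglyMeasurable, h.map_prodMk hc hg k, integral_prod _ hint,
    ← integral_map hX.aemeasurable hφ.aestronglyMeasurable]
  exact integral_mono (Integrable.of_bound hφ.aestronglyMeasurable C'
    (Filter.Eventually.of_forall hC')) hint.integral_prod_left hle

/-- Averaging over a uniformly random index. -/
theorem IsUniformIndex.integral_eq [IsProbabilityMeasure P] {K : ℕ} {J : Ω → Fin K}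
    (hJ : IsUniformIndex P X J) (hX : ∀ k, Measurable (X k)) {φ : Mat m n → ℝ}
    (hφ : Measurable φ) {C : ℝ} (hC : ∀ x, |φ x| ≤ C) :
    Integrable (fun ω => φ (X (J ω) ω)) P ∧
      ∫ ω, φ (X (J ω) ω) ∂P = (∑ k ∈ Finset.range K, ∫ ω, φ (X k ω) ∂P) / K := by
  -- Splitting over the events `J = k` lets independence factor each summand, with probability `1 /
  -- K` for the event.
  have e : (fun ω => φ (X (J ω) ω)) =
      fun ω => ∑ k : Fin K, (if J ω = k then (1 : ℝ) else 0) * φ (X k ω) := by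
    funext ω
    simp
  have hind : ∀ k : Fin K, Measurable fun j : Fin K => if j = k then (1 : ℝ) else 0 :=
    fun k => measurable_of_finite _
  have hint : ∀ k : Fin K, Integrable (fun ω => (if J ω = k then (1 : ℝ) else 0) * φ (X k ω)) P := by
    intro k
    refine Integrable.of_bound (((hind k).comp hJ.measurable).mul
      (hφ.comp (hX k))).aestronglyMeasurable C (Filter.Eventually.of_forall fun ω => ?_)
    rw [norm_mul, Real.norm_eq_abs (φ _)]
    have := hC (X k ω)
    have h0 := (abs_nonneg _).trans this
    split_ifs <;> simpa
  rw [e]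
  refine ⟨integrable_finsetSum _ fun k _ => hint k, ?_⟩
  rw [integral_finsetSum _ fun k _ => hint k, Finset.sum_range, Finset.sum_div]
  refine Finset.sum_congr rfl fun k _ => ?_
  have hi : IndepFun (fun ω => if J ω = k then (1 : ℝ) else 0) (fun ω => φ (X k ω)) P :=
    hJ.indep.comp (hind k) (hφ.comp (measurable_pi_apply k))
  rw [hi.integral_fun_mul_eq_mul_integral ((hind k).comp hJ.measurable).aestronglyMeasurable
    (hφ.comp (hX k)).aestronglyMeasurable]
  have h1 : ∫ ω, (if J ω = k then (1 : ℝ) else 0) ∂P = 1 / K := by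
    have : Nonempty (Fin K) := ⟨k⟩
    rw [← integral_map (f := fun j : Fin K => if j = k then (1 : ℝ) else 0)
      hJ.measurable.aemeasurable (hind k).aestronglyMeasurable, hJ.law]
    have e2 : (fun j : Fin K => if j = k then (1 : ℝ) else 0) = Set.indicator {k} 1 := by
      funext j
      simp [Set.indicator_apply]
    rw [e2, integral_indicator_one (measurableSet_singleton k), measureReal_def, uniformOn_univ]
    simp
  rw [h1]
  ring

end Run

end SpikeSGD

/-! ### Telescoping the expected decrease along a run -/

namespace SpikeSGD

section Run

variable {Ω Ξ : Type*} [MeasurableSpace Ω] [MeasurableSpace Ξ] {P : Measure Ω} {ν : Measure Ξ}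
  [IsProbabilityMeasure P] [IsProbabilityMeasure ν]
  {m n r : ℕ} {κ L l η c : ℝ} {f : Mat m n → ℝ} {X₀ : Mat m n} {ξ : ℕ → Ω → Ξ}
  {X : ℕ → Ω → Mat m n} {U : Mat m n → Ξ → Mat m r} {V : Mat m n → Ξ → Mat n r}

/-- The sum of the expected squared gradient norms along a run. -/
theorem IsClippedSGD.sum_integral_le (hr : 1 ≤ r)
    (hnoise : IsSpikeNoise ν U V κ) (hκ : 25 * κ * (r : ℝ) ^ 2 ≤ ((min m n : ℕ) : ℝ))
    (hsmooth : IsLSmooth f L) (hbdd : BddBelow (Set.range f)) (hL : 0 < L) (hη : 0 < η)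
    (hc : 0 ≤ c) (hl : 0 ≤ l) (hG : ∀ X, SpecLE (gradient f X) c) (hLη : L * η ≤ 1 / 3)
    (hrun : IsClippedSGD P ν (stochGrad f l U V) η c X₀ ξ X) (K : ℕ) :
    ∑ k ∈ Finset.range K, η / 6 * ∫ ω, frobNorm (gradient f (X k ω)) ^ 2 ∂P ≤
      f X₀ - (⨅ Y, f Y) + K * (L / 2 * η ^ 2 * (r * min l c ^ 2)) := by
  have hgm := measurable_stochGrad (l := l) hsmooth.continuous_gradient.measurable hnoise
  have hXm := hrun.measurable_iterate hc hgm
  have hgradm : Measurable (gradient f) := hsmooth.continuous_gradient.measurable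
  let δ : Mat m n × Ξ → ℝ := fun p => guaranteedDecrease L η (gradient f p.1)
    (spectralClip c (stochGrad f l U V p.1 p.2))
  have hδ : Measurable δ := measurable_guaranteedDecrease (hgradm.comp measurable_fst)
    ((continuous_spectralClip hc).measurable.comp hgm)
  obtain ⟨C, hC⟩ : ∃ C, ∀ p, |δ p| ≤ C :=
    ⟨_, fun p => abs_guaranteedDecrease_le hL.le hη.le (hG p.1) (specLE_spectralClip hc _)⟩
  set N := L / 2 * η ^ 2 * (r * min l c ^ 2)
  let h : Mat m n → ℝ := fun x => frobInner (gradient f x) (gradient f x)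
  have hm : Measurable h := Measurable.frobInner hgradm hgradm
  have hb : ∀ x, |h x| ≤ n * c ^ 2 := fun x => by
    rw [abs_of_nonneg (frobInner_self_nonneg _)]
    exact (hG x).frobInner_self_le
  have hih : ∀ k, Integrable (fun ω => h (X k ω)) P := fun k =>
    Integrable.of_bound (hm.comp (hXm k)).aestronglyMeasurable _
      (Filter.Eventually.of_forall fun ω => hb _)
  have hφb : ∀ x, |η / 6 * h x - N| ≤ η / 6 * (n * c ^ 2) + |N| := fun x => by
    refine (abs_sub _ _).trans ?_
    rw [abs_mul, abs_of_nonneg (by positivity : 0 ≤ η / 6)]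
    have := hb x
    gcongr
  have hstep : ∀ k, η / 6 * ∫ ω, h (X k ω) ∂P - N ≤ ∫ ω, δ (X k ω, ξ k ω) ∂P := fun k => by
    have := hrun.integral_ge hc hgm k hδ hC (φ := fun x => η / 6 * h x - N)
      ((hm.const_mul _).sub_const _) hφb fun x =>
        integral_guaranteedDecrease_ge hr hnoise hκ hsmooth hL hη hc hl x (hG x) hLη
    rwa [integral_sub ((hih k).const_mul _) (integrable_const _), integral_const_mul,
      integral_const, probReal_univ, one_smul] at this
  have hdesc : ∀ k ω, f (X (k + 1) ω) ≤ f (X k ω) - δ (X k ω, ξ k ω) := fun k ω => by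
    rw [hrun.step]
    exact hsmooth.step_le _ _
  have hinf : ∀ x, (⨅ Y, f Y) ≤ f x := fun x => ciInf_le hbdd x
  -- `f` may be unbounded above, but each step raises it by at most `C`, so every `f (X k)` is
  -- bounded and hence integrable.
  have hup : ∀ k ω, f (X k ω) ≤ f X₀ + k * C := by
    intro k ω
    induction k with
    | zero => simp [hrun.init]
    | succ k ih =>
      have h1 := hdesc k ω
      have h2 := (abs_le.mp (hC (X k ω, ξ k ω))).1
      push_cast
      linarith
  have hif : ∀ k, Integrable (fun ω => f (X k ω)) P := fun k =>
    Integrable.of_mem_Icc (⨅ Y, f Y) (f X₀ + k * C)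
      (hsmooth.continuous.measurable.comp (hXm k)).aemeasurable
      (Filter.Eventually.of_forall fun ω => ⟨hinf _, hup k ω⟩)
  have hiδ : ∀ k, Integrable (fun ω => δ (X k ω, ξ k ω)) P := fun k =>
    Integrable.of_bound (hδ.comp ((hXm k).prodMk (hrun.measurable k))).aestronglyMeasurable C
      (Filter.Eventually.of_forall fun ω => hC _)
  have hE : ∀ k, ∫ ω, f (X (k + 1) ω) ∂P ≤
      ∫ ω, f (X k ω) ∂P - (η / 6 * ∫ ω, h (X k ω) ∂P - N) := fun k => by
    have h1 := integral_mono (hif (k + 1)) ((hif k).sub (hiδ k)) (hdesc k)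
    rw [integral_sub' (hif k) (hiδ k)] at h1
    have := hstep k
    linarith
  have hsum : ∀ k, ∫ ω, f (X k ω) ∂P + ∑ j ∈ Finset.range k, η / 6 * ∫ ω, h (X j ω) ∂P ≤
      f X₀ + k * N := by
    intro k
    induction k with
    | zero => simp [hrun.init]
    | succ k ih =>
      rw [Finset.sum_range_succ]
      have := hE k
      push_cast
      linarith
  have hlow : (⨅ Y, f Y) ≤ ∫ ω, f (X K ω) ∂P := by
    have := integral_mono (integrable_const (μ := P) (⨅ Y, f Y)) (hif K) fun ω => hinf (X K ω)
    simpa using this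
  have := hsum K
  simp only [frobNorm_sq]
  change ∑ k ∈ Finset.range K, η / 6 * ∫ ω, h (X k ω) ∂P ≤ _
  linarith

end Run

/-- The iteration count is equivalent, up to constants, to its simplified form. -/
theorem iterationCount_bounds {a l A D : ℝ} (ha : 0 ≤ a) (hl : 0 ≤ l) (hA : 0 ≤ A) (hD : 0 ≤ D) :
    36 * (A + min a l ^ 2 * D) ≤ 36 * A + 72 * min (10 * a) (10 * l / 9) ^ 2 * D ∧
    36 * A + 72 * min (10 * a) (10 * l / 9) ^ 2 * D ≤ 7200 * (A + min a l ^ 2 * D) := by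
  have h0 : 0 ≤ min a l := le_min ha hl
  -- The two minima agree up to a factor 10, whose square turns 72 into 7200.
  have h1 : min a l ≤ min (10 * a) (10 * l / 9) :=
    le_min ((min_le_left _ _).trans (by linarith)) ((min_le_right _ _).trans (by linarith))
  have h2 : min (10 * a) (10 * l / 9) ≤ 10 * min a l := by
    rcases le_total a l with h | h
    · rw [min_eq_left h]; exact min_le_left _ _
    · rw [min_eq_right h]; exact (min_le_right _ _).trans (by linarith)
  have h3 := mul_le_mul_of_nonneg_right (pow_le_pow_left₀ h0 h1 2) hD
  have h4 := mul_le_mul_of_nonneg_right (pow_le_pow_left₀ (h0.trans h1) h2 2) hD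
  have h5 : 0 ≤ min a l ^ 2 * D := by positivity
  constructor <;> linarith

end SpikeSGD

/-! ### The main theorem: choice of step size and iteration count -/

theorem theorem2 {m n r : ℕ} (hr : 1 ≤ r)
    -- the objective: L-smooth, bounded below, gradient of spectral norm at most M
    (f : SpikeSGD.Mat m n → ℝ) (L M : ℝ) (hL : 0 < L) (hM : 0 < M)
    (hsmooth : SpikeSGD.IsLSmooth f L)
    (hgrad : ∀ X, SpikeSGD.specNorm (SpikeSGD.gradient f X) ≤ M)
    (hbdd : BddBelow (Set.range f))
    -- the spike noise
    {Ξ : Type*} [MeasurableSpace Ξ] (ν : Measure Ξ) [IsProbabilityMeasure ν]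
    (U : SpikeSGD.Mat m n → Ξ → SpikeSGD.Mat m r) (V : SpikeSGD.Mat m n → Ξ → SpikeSGD.Mat n r)
    (κ : ℝ) (hnoise : SpikeSGD.IsSpikeNoise ν U V κ)
    (hκ : 25 * κ * (r : ℝ) ^ 2 ≤ ((min m n : ℕ) : ℝ))
    (l : ℝ) (hl : 0 < l)
    -- the accuracy, the step size and the clipping threshold
    (ε : ℝ) (hε : 0 < ε) (η c : ℝ)
    (hη : η = 1 / (6 * r * L * min (10 * Real.sqrt r * M) (10 * l / 9) ^ 2 / ε ^ 2 + 3 * L))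
    (hc : c = 10 * Real.sqrt r * M)
    -- the run of the method
    {Ω : Type*} [MeasurableSpace Ω] (P : Measure Ω) [IsProbabilityMeasure P]
    (X₀ : SpikeSGD.Mat m n) (ξ : ℕ → Ω → Ξ) (X : ℕ → Ω → SpikeSGD.Mat m n)
    (hrun : SpikeSGD.IsClippedSGD P ν (SpikeSGD.stochGrad f l U V) η c X₀ ξ X)
    -- the initial gap and the iteration count
    (F₀ B : ℝ) (hF₀ : F₀ = f X₀ - ⨅ Y, f Y)
    (hB : B = 36 * L * F₀ / ε ^ 2 +
      72 * min (10 * Real.sqrt r * M) (10 * l / 9) ^ 2 * (r * L * F₀ / ε ^ 4)) :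
    (∀ (K : ℕ) (J : Ω → Fin K), 1 ≤ K → B ≤ K → SpikeSGD.IsUniformIndex P X J →
      Integrable (fun ω => SpikeSGD.frobNorm (SpikeSGD.gradient f (X (J ω) ω)) ^ 2) P ∧
      ∫ ω, SpikeSGD.frobNorm (SpikeSGD.gradient f (X (J ω) ω)) ^ 2 ∂P ≤ ε ^ 2) ∧
    36 * (L * F₀ / ε ^ 2 + min (Real.sqrt r * M) l ^ 2 * (r * L * F₀ / ε ^ 4)) ≤ B ∧
    B ≤ 7200 * (L * F₀ / ε ^ 2 + min (Real.sqrt r * M) l ^ 2 * (r * L * F₀ / ε ^ 4)) := by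
  have hr' : (1 : ℝ) ≤ r := by exact_mod_cast hr
  have hsr : 1 ≤ Real.sqrt r := Real.one_le_sqrt.mpr hr'
  have hMc : M ≤ c := by rw [hc]; nlinarith
  have hc0 : 0 ≤ c := hM.le.trans hMc
  have hF : 0 ≤ F₀ := by
    rw [hF₀]
    exact sub_nonneg.mpr (ciInf_le hbdd X₀)
  have hG : ∀ x, SpikeSGD.SpecLE (SpikeSGD.gradient f x) c := fun x =>
    SpikeSGD.specLE_of_specNorm_le ((hgrad x).trans hMc)
  have hcl : min l c ≤ min (10 * Real.sqrt r * M) (10 * l / 9) := by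
    rw [← hc]
    exact le_min (min_le_right _ _) ((min_le_left _ _).trans (by linarith))
  have hcl0 : 0 ≤ min l c := le_min hl.le hc0
  refine ⟨fun K J hK hBK hJ => ?_, ?_⟩
  · set τ := min (10 * Real.sqrt r * M) (10 * l / 9)
    set D := 6 * r * L * τ ^ 2 / ε ^ 2 + 3 * L with hD
    have hK' : (0 : ℝ) < K := by exact_mod_cast hK
    have h6 : 0 ≤ 6 * r * L * τ ^ 2 / ε ^ 2 := by positivity
    have hD0 : 0 < D := by positivity
    have hη0 : 0 < η := by rw [hη]; positivity
    have hηD : η * D = 1 := by rw [hη]; field_simp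
    have hLη : L * η ≤ 1 / 3 := by nlinarith
    have hnoiseτ : L * η * (r * τ ^ 2) ≤ ε ^ 2 / 6 := by
      have h1 : η * (6 * r * L * τ ^ 2 / ε ^ 2) ≤ 1 := by nlinarith
      rw [← mul_div_assoc, div_le_one (by positivity)] at h1
      linarith
    have hcτ := pow_le_pow_left₀ hcl0 hcl 2
    -- The target per step is `η ε² / 6`. Half goes to the noise here, and half to the initial gap
    -- in `hFK`, where `B` is exactly `12 F₀ / (η ε²)`.
    have hN : L / 2 * η ^ 2 * (r * min l c ^ 2) ≤ η * ε ^ 2 / 12 := by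
      have h1 : L * η * (r * min l c ^ 2) ≤ ε ^ 2 / 6 := by
        refine le_trans ?_ hnoiseτ
        gcongr
      nlinarith
    have hFK : F₀ ≤ K * (η * ε ^ 2 / 12) := by
      have e : B = 12 * F₀ * D / ε ^ 2 := by
        rw [hB, hD]
        field_simp
        ring
      rw [e, div_le_iff₀ (by positivity)] at hBK
      have h1 := mul_le_mul_of_nonneg_left hBK hη0.le
      have h2 : η * (12 * F₀ * D) = 12 * F₀ * (η * D) := by ring
      rw [h2, hηD] at h1
      linarith
    have hsum := hrun.sum_integral_le hr hnoise hκ hsmooth hbdd hL hη0 hc0 hl.le hG hLη K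
    have hXm := hrun.measurable_iterate hc0
      (SpikeSGD.measurable_stochGrad hsmooth.continuous_gradient.measurable hnoise)
    obtain ⟨hint, heq⟩ := hJ.integral_eq (φ := fun x => SpikeSGD.frobNorm (SpikeSGD.gradient f x) ^ 2)
      (C := n * c ^ 2) hXm
      ((SpikeSGD.continuous_frobNorm.comp hsmooth.continuous_gradient).pow 2).measurable
      (fun x => by
        rw [abs_of_nonneg (sq_nonneg _), SpikeSGD.frobNorm_sq]
        exact (hG x).frobInner_self_le)
    refine ⟨hint, ?_⟩
    rw [heq, div_le_iff₀ hK']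
    rw [← Finset.mul_sum, ← hF₀] at hsum
    have hKN := mul_le_mul_of_nonneg_left hN hK'.le
    refine le_of_mul_le_mul_left ?_ hη0
    linarith
  · rw [hB]
    have h := SpikeSGD.iterationCount_bounds (a := Real.sqrt r * M) (l := l)
      (A := L * F₀ / ε ^ 2) (D := r * L * F₀ / ε ^ 4) (by positivity) hl.le (by positivity)
      (by positivity)
    rw [← mul_assoc 10 (Real.sqrt r) M] at h
    have e : 36 * L * F₀ / ε ^ 2 = 36 * (L * F₀ / ε ^ 2) := by ring
    rw [e]
    exact h
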